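/- Let $\mathbb F$ be $\mathbb R$ or $\mathbb C$, let $\Omega$ be a locally compact Hausdorff space, let $C_b(\Omega)$ be the space of bounded continuous functions $\Omega\to\mathbb F$ with the supremum norm $\|\cdot\|_\infty$, and let $C_0(\Omega)\subseteq C_b(\Omega)$ be the subspace of functions vanishing at infinity. For $f\in C_b(\Omega)$ and a linear subspace $\mathcal B\subseteq C_b(\Omega)$, we say that $f$ is Birkhoff–James orthogonal to $\mathcal B$ if $\|f\|_\infty\le\|f+h\|_\infty$ for all $h\in\mathcal B$. Let $f\in C_b(\Omega)$ satisfy $\operatorname{dist}(f,C_0(\Omega)):=\inf_{g\in C_0(\Omega)}\|f-g\|_\infty<\|f\|_\infty$, and let $\mathcal B$ be a (not necessarily closed) linear subspace of $C_b(\Omega)$. Then $f$ is Birkhoff–James orthogonal to $\mathcal B$ if and only if there exists a regular Borel probability measure $\mu$ on $\Omega$ whose support is contained in $\{x\in\Omega : |f(x)|=\|f\|_\infty\}$ and such that $$\int_\Omega \overline{f}\,h\,d\mu=0\quad\text{for all }h\in\mathcal B.$$ Moreover, if $|f|$ attains $\|f\|_\infty$ at exactly one point $x_0\in\Omega$, then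 $f$ is Birkhoff–James orthogonal to $\mathcal B$ if and only if $h(x_0)=0$ for all $h\in\mathcal B$. -/

import Mathlib

open MeasureTheory
open scoped BoundedContinuousFunction ZeroAtInfty

/-- A vector `v` of a normed space `V` is Birkhoff-James orthogonal to a subspace `W` if
`‖v‖ ≤ ‖v + w‖` for all `w ∈ W`. -/
def BirkhoffJamesOrthogonal (𝕜 : Type*) {V : Type*} [RCLike 𝕜] [NormedAddCommGroup V]
    [NormedSpace 𝕜 V] (v : V) (W : Submodule 𝕜 V) : Prop :=
  ∀ w ∈ W, ‖v‖ ≤ ‖v + w‖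

/-- `C₀(Ω)` as a subset of `C_b(Ω)`. -/
def zeroAtInftySet (Ω 𝕜 : Type*) [TopologicalSpace Ω] [RCLike 𝕜] : Set (Ω →ᵇ 𝕜) :=
  Set.range (fun g : C₀(Ω, 𝕜) => g.toBCF)

/-! Let M be the set where |f| attains its norm. The distance hypothesis makes M compact and keeps
|f| below a level less than ‖f‖ outside a compact set. By Kolmogorov's criterion, orthogonality then
forbids Re(conj f · h) from being strictly positive on M for any h in B. Hahn–Banach separates these
restrictions from the open convex cone of positive functions in C(M, ℝ), and Riesz–Markov turns the
separating functional into a probability measure on M, pushed forward to Ω. Conversely, such a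
measure gives ‖f‖² = |∫ conj f · (f + h) dμ| ≤ ‖f‖ ‖f + h‖. -/

/-- If `f` is at distance less than `‖f‖` from `C₀(Ω)`, then `f` exceeds some level below `‖f‖`
only on a compact set. -/
theorem exists_isCompact_setOf_le_norm {𝕜 Ω : Type*} [RCLike 𝕜] [TopologicalSpace Ω]
    (f : Ω →ᵇ 𝕜) (hf : Metric.infDist f (zeroAtInftySet Ω 𝕜) < ‖f‖) :
    ∃ c < ‖f‖, IsCompact {x | c ≤ ‖f x‖} := by
  have hne : (zeroAtInftySet Ω 𝕜).Nonempty := ⟨_, ⟨0, rfl⟩⟩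
  obtain ⟨_, ⟨g, rfl⟩, hg⟩ := (Metric.infDist_lt_iff hne).1 hf
  obtain ⟨c, hgc, hcf⟩ := exists_between hg
  refine ⟨c, hcf, ?_⟩
  have htend : Filter.Tendsto (fun x => ‖g x‖) (Filter.cocompact Ω) (nhds 0) := by
    simpa using (zero_at_infty g).norm
  obtain ⟨K, hK, hKg⟩ := Filter.mem_cocompact.1
    (htend.eventually (gt_mem_nhds (sub_pos.2 hgc)))
  refine hK.of_isClosed_subset (isClosed_le continuous_const f.continuous.norm) fun x hx => ?_
  by_contra hxK
  have h1 : ‖g x‖ < c - dist f g.toBCF := hKg hxK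
  have h2 : dist (f x) (g x) ≤ dist f g.toBCF := f.dist_coe_le_dist (g := g.toBCF) x
  have h3 : ‖f x‖ ≤ dist (f x) (g x) + ‖g x‖ := by
    rw [dist_eq_norm]; exact norm_le_norm_sub_add _ _
  have h4 : c ≤ ‖f x‖ := hx
  linarith

theorem continuous_conj_mul {𝕜 Ω : Type*} [RCLike 𝕜] [TopologicalSpace Ω] (f h : Ω →ᵇ 𝕜) :
    Continuous fun x => (starRingEnd 𝕜) (f x) * h x :=
  (RCLike.continuous_conj.comp f.continuous).mul h.continuous

theorem continuous_re_conj_mul {𝕜 Ω : Type*} [RCLike 𝕜] [TopologicalSpace Ω] (f h : Ω →ᵇ 𝕜) :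
    Continuous fun x => RCLike.re ((starRingEnd 𝕜) (f x) * h x) :=
  RCLike.continuous_re.comp (continuous_conj_mul f h)

/-- Kolmogorov's criterion: if no element `f - t • h` with `t > 0` has norm below `‖f‖`, then
`conj f * h` has nonpositive real part at some point where `|f|` attains its maximum. -/
theorem exists_norm_eq_re_conj_mul_nonpos {𝕜 Ω : Type*} [RCLike 𝕜] [TopologicalSpace Ω]
    (f h : Ω →ᵇ 𝕜) {c : ℝ} (hc : c < ‖f‖) (hK : IsCompact {x | c ≤ ‖f x‖})
    (hf : f ≠ 0) (hle : ∀ t : ℝ, 0 < t → ‖f‖ ≤ ‖f - (t : 𝕜) • h‖) :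
    ∃ x, ‖f x‖ = ‖f‖ ∧ RCLike.re ((starRingEnd 𝕜) (f x) * h x) ≤ 0 := by
  by_contra! hpos
  -- This maximum is positive everywhere, so compactness gives it a uniform lower bound: each point
  -- has either a norm gap or a real part of at least δ.
  have hcont : Continuous fun x =>
      max (‖f‖ - ‖f x‖) (RCLike.re ((starRingEnd 𝕜) (f x) * h x)) :=
    (continuous_const.sub f.continuous.norm).max (continuous_re_conj_mul f h)
  obtain ⟨δ', hδ', hmax⟩ := hK.exists_forall_le' hcont.continuousOn (a := 0) fun x _ => by
    rcases (f.norm_coe_le_norm x).lt_or_eq with hx | hx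
    · exact lt_max_of_lt_left (sub_pos.2 hx)
    · exact lt_max_of_lt_right (hpos x hx)
  obtain ⟨δ, hδ, hδδ', hδc⟩ : ∃ δ, 0 < δ ∧ δ ≤ δ' ∧ δ ≤ ‖f‖ - c :=
    ⟨min δ' (‖f‖ - c), lt_min hδ' (sub_pos.2 hc), min_le_left _ _, min_le_right _ _⟩
  have hcase : ∀ x, ‖f x‖ ≤ ‖f‖ - δ ∨ δ ≤ RCLike.re ((starRingEnd 𝕜) (f x) * h x) := by
    intro x
    rcases le_or_gt c ‖f x‖ with hx | hx
    · rcases le_max_iff.1 (hδδ'.trans (hmax x hx)) with h1 | h1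
      · left; linarith
      · exact Or.inr h1
    · left; linarith
  set H := ‖h‖ + 1 with hH
  have hH1 : 1 ≤ H := by linarith [norm_nonneg h]
  -- The step t is small enough that t‖h‖ uses at most half of the gap δ, and that the quadratic
  -- term t²‖h‖² cannot offset the decrease 2tδ of |f - th|².
  have hhH : ∀ x, ‖h x‖ ≤ H := fun x => by linarith [h.norm_coe_le_norm x]
  set t := δ / (2 * H ^ 2) with ht
  have ht0 : 0 < t := by positivity
  have htH2 : t * H ^ 2 = δ / 2 := by rw [ht]; field_simp
  have htH : t * H ≤ δ / 2 := by
    rw [← htH2]; exact mul_le_mul_of_nonneg_left (by nlinarith) ht0.le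
  have hf0 : 0 < ‖f‖ := norm_pos_iff.2 hf
  have hb : ‖f - (t : 𝕜) • h‖ ≤ max (‖f‖ - δ / 2) √(‖f‖ ^ 2 - t * δ) := by
    refine (BoundedContinuousFunction.norm_le (le_max_of_le_right (Real.sqrt_nonneg _))).2
      fun x => ?_
    have hth : ‖(t : 𝕜) * h x‖ = t * ‖h x‖ := by
      rw [norm_mul, RCLike.norm_ofReal, abs_of_pos ht0]
    change ‖f x - (t : 𝕜) * h x‖ ≤ _
    rcases hcase x with hx | hx
    · refine le_max_of_le_left ((norm_sub_le _ _).trans ?_)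
      have := mul_le_mul_of_nonneg_left (hhH x) ht0.le
      linarith
    · refine le_max_of_le_right (Real.le_sqrt_of_sq_le ?_)
      have hre : RCLike.re (inner 𝕜 (f x) ((t : 𝕜) * h x)) =
          t * RCLike.re ((starRingEnd 𝕜) (f x) * h x) := by
        rw [RCLike.inner_apply', ← RCLike.re_ofReal_mul]
        congr 1
        ring
      rw [norm_sub_sq (𝕜 := 𝕜), hre, hth]
      have h1 : ‖f x‖ ^ 2 ≤ ‖f‖ ^ 2 :=
        pow_le_pow_left₀ (norm_nonneg _) (f.norm_coe_le_norm x) 2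
      have h2 : (t * ‖h x‖) ^ 2 ≤ t * (δ / 2) := by
        rw [← htH2, mul_pow, ← mul_assoc, ← sq]
        exact mul_le_mul_of_nonneg_left (pow_le_pow_left₀ (norm_nonneg _) (hhH x) 2) (sq_nonneg t)
      have h3 := mul_le_mul_of_nonneg_left hx ht0.le
      nlinarith [mul_pos ht0 hδ]
  have hlt : max (‖f‖ - δ / 2) √(‖f‖ ^ 2 - t * δ) < ‖f‖ :=
    max_lt (by linarith) ((Real.sqrt_lt' hf0).2 (by nlinarith [mul_pos ht0 hδ]))
  exact absurd (hle t ht0) (not_le.2 (hb.trans_lt hlt))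

/-- A subspace of `C(X, ℝ)`, `X` compact, without strictly positive elements is annihilated by a
regular probability measure. -/
theorem exists_probabilityMeasure_integral_eq_zero {X : Type*} [TopologicalSpace X]
    [CompactSpace X] [T2Space X] [MeasurableSpace X] [BorelSpace X] (S : Submodule ℝ C(X, ℝ))
    (hS : ∀ g ∈ S, ∃ x, g x ≤ 0) :
    ∃ μ : Measure X, IsProbabilityMeasure μ ∧ μ.Regular ∧ ∀ g ∈ S, ∫ x, g x ∂μ = 0 := by
  set P : Set C(X, ℝ) := {g | Set.MapsTo g Set.univ (Set.Ioi 0)} with hP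
  have hPo : IsOpen P := ContinuousMap.isOpen_setOfPred_mapsTo isCompact_univ isOpen_Ioi
  have hPc : Convex ℝ P := fun g hg g' hg' a b ha hb hab x hx =>
    convex_Ioi (0 : ℝ) (hg hx) (hg' hx) ha hb hab
  have hdisj : Disjoint P (S : Set C(X, ℝ)) := by
    refine Set.disjoint_left.2 fun g hg hgS => ?_
    obtain ⟨x, hx⟩ := hS g hgS
    exact absurd (hg (Set.mem_univ x)) (not_lt.2 hx)
  obtain ⟨φ, u, hφP, hφS⟩ := geometric_hahn_banach_open hPc hPo S.convex hdisj
  have hu : u ≤ 0 := by simpa using hφS 0 S.zero_mem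
  have hneg : ∀ g ∈ P, φ g < 0 := fun g hg => (hφP g hg).trans_le hu
  have hzero : ∀ g ∈ S, φ g = 0 := by
    intro g hg
    by_contra hne
    -- A functional bounded below on a subspace vanishes there: otherwise a multiple of g reaches
    -- the value u - 1.
    have := hφS (((u - 1) / φ g) • g) (S.smul_mem _ hg)
    rw [map_smul, smul_eq_mul, div_mul_cancel₀ _ hne] at this
    linarith
  have hone : φ 1 < 0 := hneg 1 fun x _ => by simp
  have hnonpos : ∀ g : C(X, ℝ), 0 ≤ g → φ g ≤ 0 := by
    intro g hg
    by_contra! hlt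
    -- With this ε, φ(g + ε) = 0, although g + ε is strictly positive.
    set ε := φ g / (-φ 1) with hε
    have hε0 : 0 < ε := div_pos hlt (neg_pos.2 hone)
    have h1 : φ (g + ε • 1) < 0 := hneg _ fun x _ => by
      have : 0 ≤ g x := hg x
      simp only [ContinuousMap.add_apply, ContinuousMap.smul_apply, ContinuousMap.one_apply,
        smul_eq_mul, mul_one, Set.mem_Ioi]
      linarith
    have h2 : ε * φ 1 = - φ g := by
      rw [hε, div_neg, neg_mul, div_mul_cancel₀ _ hone.ne]
    rw [map_add, map_smul, smul_eq_mul, h2] at h1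
    linarith
  -- Dividing by φ 1 < 0 makes the functional positive and gives its measure total mass 1.
  let Λ : CompactlySupportedContinuousMap X ℝ →ₚ[ℝ] ℝ := PositiveLinearMap.mk₀
    { toFun g := φ g.toContinuousMap / φ 1
      map_add' g g' := by
        rw [← add_div, ← map_add]; rfl
      map_smul' r g := by
        rw [RingHom.id_apply, smul_eq_mul, ← mul_div_assoc, ← smul_eq_mul r, ← map_smul]; rfl }
    fun g hg => div_nonneg_of_nonpos (hnonpos _ hg) hone.le
  have hint : ∀ g : C(X, ℝ), ∫ x, g x ∂(RealRMK.rieszMeasure Λ) = φ g / φ 1 := fun g =>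
    RealRMK.integral_rieszMeasure Λ (CompactlySupportedContinuousMap.continuousMapEquiv g)
  refine ⟨RealRMK.rieszMeasure Λ, ⟨?_⟩, inferInstance, fun g hg => by
    rw [hint, hzero g hg, zero_div]⟩
  have h1 := hint 1
  rw [div_self hone.ne] at h1
  simp only [ContinuousMap.one_apply, integral_const, smul_eq_mul, mul_one] at h1
  exact (ENNReal.toReal_eq_one_iff _).1 h1

/-- The real linear map sending `h` to the restriction of `Re (conj f * h)` to `M`. -/
noncomputable def reConjMulRestrict {𝕜 Ω : Type*} [RCLike 𝕜] [TopologicalSpace Ω] (f : Ω →ᵇ 𝕜)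
    (M : Set Ω) : (Ω →ᵇ 𝕜) →ₗ[ℝ] C(M, ℝ) where
  toFun h := ⟨fun x => RCLike.re ((starRingEnd 𝕜) (f x) * h x),
    (continuous_re_conj_mul f h).comp continuous_subtype_val⟩
  map_add' h h' := by ext x; simp [mul_add]
  map_smul' r h := by
    ext x
    simp only [BoundedContinuousFunction.coe_smul, ContinuousMap.coe_mk, mul_smul_comm,
      RCLike.smul_re, RingHom.id_apply, ContinuousMap.smul_apply, smul_eq_mul]

theorem integrable_conj_mul {𝕜 Ω : Type*} [RCLike 𝕜] [TopologicalSpace Ω] [MeasurableSpace Ω]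
    [OpensMeasurableSpace Ω] (f h : Ω →ᵇ 𝕜) (μ : Measure Ω) [IsFiniteMeasure μ] :
    Integrable (fun x => (starRingEnd 𝕜) (f x) * h x) μ := by
  refine .of_bound (continuous_conj_mul f h).aestronglyMeasurable (‖f‖ * ‖h‖)
    (.of_forall fun x => ?_)
  rw [norm_mul, RCLike.norm_conj]
  exact mul_le_mul (f.norm_coe_le_norm x) (h.norm_coe_le_norm x) (norm_nonneg _) (norm_nonneg _)

theorem ae_norm_eq_of_support_subset {𝕜 Ω : Type*} [RCLike 𝕜] [TopologicalSpace Ω]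
    [MeasurableSpace Ω] [OpensMeasurableSpace Ω] {f : Ω →ᵇ 𝕜} {μ : Measure Ω} [μ.Regular]
    (hμ : μ.support ⊆ {x : Ω | ‖f x‖ = ‖f‖}) : ∀ᵐ x ∂μ, ‖f x‖ = ‖f‖ :=
  Filter.mem_of_superset Measure.support_mem_ae_of_regular hμ

theorem BirkhoffJamesOrthogonal.exists_measure {𝕜 Ω : Type*} [RCLike 𝕜] [TopologicalSpace Ω]
    [T2Space Ω] [MeasurableSpace Ω] [BorelSpace Ω] {f : Ω →ᵇ 𝕜}
    (hf : Metric.infDist f (zeroAtInftySet Ω 𝕜) < ‖f‖) {B : Submodule 𝕜 (Ω →ᵇ 𝕜)}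
    (hB : BirkhoffJamesOrthogonal 𝕜 f B) :
    ∃ μ : Measure Ω, IsProbabilityMeasure μ ∧ μ.Regular ∧
      μ.support ⊆ {x : Ω | ‖f x‖ = ‖f‖} ∧
      ∀ h ∈ B, ∫ x, (starRingEnd 𝕜) (f x) * h x ∂μ = 0 := by
  obtain ⟨c, hc, hK⟩ := exists_isCompact_setOf_le_norm f hf
  have hf0 : f ≠ 0 := norm_pos_iff.1 (Metric.infDist_nonneg.trans_lt hf)
  set M : Set Ω := {x | ‖f x‖ = ‖f‖} with hM
  have hMclosed : IsClosed M := isClosed_eq f.continuous.norm continuous_const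
  have hMcompact : IsCompact M := hK.of_isClosed_subset hMclosed fun x hx =>
    hc.le.trans (Eq.ge hx)
  have : CompactSpace M := isCompact_iff_compactSpace.1 hMcompact
  obtain ⟨ν, hν, hνreg, hνB⟩ := exists_probabilityMeasure_integral_eq_zero
    ((B.restrictScalars ℝ).map (reConjMulRestrict f M)) (by
      rintro _ ⟨h, hh, rfl⟩
      obtain ⟨x, hx, hxh⟩ := exists_norm_eq_re_conj_mul_nonpos f h hc hK hf0 fun t _ => by
        rw [sub_eq_add_neg]
        exact hB _ (B.neg_mem (B.smul_mem _ hh))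
      exact ⟨⟨x, hx⟩, hxh⟩)
  have hprob : IsProbabilityMeasure (ν.map Subtype.val) :=
    Measure.isProbabilityMeasure_map (by fun_prop)
  have hreg : (ν.map (Subtype.val : M → Ω)).InnerRegularCompactLTTop :=
    .map_of_continuous continuous_subtype_val
  refine ⟨ν.map Subtype.val, hprob, inferInstance,
    Measure.support_subset_of_isClosed hMclosed ?_, fun h hh => ?_⟩
  · rw [mem_ae_iff, Measure.map_apply (by fun_prop) hMclosed.measurableSet.compl]
    simp
  · have hre : ∀ k ∈ B,
        RCLike.re (∫ x, (starRingEnd 𝕜) (f x) * k x ∂(ν.map Subtype.val)) = 0 := by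
      intro k hk
      rw [← integral_re (integrable_conj_mul f k _), integral_map (by fun_prop)
        (continuous_re_conj_mul f k).aestronglyMeasurable]
      exact hνB _ ⟨k, hk, rfl⟩
    -- Since B is 𝕜-linear, testing I • h yields the imaginary part.
    have him := hre ((RCLike.I : 𝕜) • h) (B.smul_mem _ hh)
    simp only [BoundedContinuousFunction.coe_smul, smul_eq_mul, mul_left_comm _ (RCLike.I : 𝕜),
      integral_const_mul, RCLike.I_mul_re, neg_eq_zero] at him
    exact RCLike.ext (by simpa using hre h hh) (by simpa using him)

theorem birkhoffJamesOrthogonal_of_measure {𝕜 Ω : Type*} [RCLike 𝕜] [TopologicalSpace Ω]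
    [MeasurableSpace Ω] [OpensMeasurableSpace Ω] {f : Ω →ᵇ 𝕜} {B : Submodule 𝕜 (Ω →ᵇ 𝕜)}
    (μ : Measure Ω) [IsProbabilityMeasure μ] [μ.Regular]
    (hμ : μ.support ⊆ {x : Ω | ‖f x‖ = ‖f‖})
    (hB : ∀ h ∈ B, ∫ x, (starRingEnd 𝕜) (f x) * h x ∂μ = 0) :
    BirkhoffJamesOrthogonal 𝕜 f B := by
  intro h hh
  rcases eq_or_ne f 0 with rfl | hf
  · simp
  have hff : ∫ x, (starRingEnd 𝕜) (f x) * f x ∂μ = ((‖f‖ ^ 2 : ℝ) : 𝕜) := by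
    rw [integral_congr_ae (g := fun _ => ((‖f‖ ^ 2 : ℝ) : 𝕜))]
    · simp
    · filter_upwards [ae_norm_eq_of_support_subset hμ] with x hx
      rw [RCLike.conj_mul, hx, RCLike.ofReal_pow]
  have hsum : ∫ x, (starRingEnd 𝕜) (f x) * (f + h) x ∂μ = ((‖f‖ ^ 2 : ℝ) : 𝕜) := by
    simp only [BoundedContinuousFunction.coe_add, Pi.add_apply, mul_add]
    rw [integral_add (integrable_conj_mul f f μ) (integrable_conj_mul f h μ), hff, hB h hh,
      add_zero]
  have hbound : ‖∫ x, (starRingEnd 𝕜) (f x) * (f + h) x ∂μ‖ ≤ ‖f‖ * ‖f + h‖ := by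
    refine (norm_integral_le_of_norm_le_const (C := ‖f‖ * ‖f + h‖) (.of_forall fun x => ?_)).trans
      (by simp)
    rw [norm_mul, RCLike.norm_conj]
    exact mul_le_mul (f.norm_coe_le_norm x) ((f + h).norm_coe_le_norm x) (norm_nonneg _)
      (norm_nonneg _)
  rw [hsum, RCLike.norm_ofReal, abs_of_nonneg (sq_nonneg _), sq] at hbound
  exact le_of_mul_le_mul_left hbound (norm_pos_iff.2 hf)

theorem mainTheorem9 {𝕜 : Type*} [RCLike 𝕜] {Ω : Type*} [TopologicalSpace Ω] [T2Space Ω]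
    [LocallyCompactSpace Ω] [MeasurableSpace Ω] [BorelSpace Ω] (f : Ω →ᵇ 𝕜)
    (hf : Metric.infDist f (zeroAtInftySet Ω 𝕜) < ‖f‖) (B : Submodule 𝕜 (Ω →ᵇ 𝕜)) :
    (BirkhoffJamesOrthogonal 𝕜 f B ↔
      ∃ μ : Measure Ω, IsProbabilityMeasure μ ∧ μ.Regular ∧
        μ.support ⊆ {x : Ω | ‖f x‖ = ‖f‖} ∧
        ∀ h ∈ B, ∫ x, (starRingEnd 𝕜) (f x) * h x ∂μ = 0) ∧
    (∀ x₀ : Ω, {x : Ω | ‖f x‖ = ‖f‖} = {x₀} →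
      (BirkhoffJamesOrthogonal 𝕜 f B ↔ ∀ h ∈ B, h x₀ = 0)) := by 
  refine ⟨⟨fun hB => hB.exists_measure hf, fun ⟨μ, hμ, hreg, hsupp, hB⟩ =>
    birkhoffJamesOrthogonal_of_measure μ hsupp hB⟩, fun x₀ hx₀ => ⟨fun hB h hh => ?_,
    fun hB h hh => ?_⟩⟩
  · obtain ⟨μ, hμ, hreg, hsupp, hint⟩ := hB.exists_measure hf
    have hae : ∀ᵐ x ∂μ, x = x₀ :=
      (ae_norm_eq_of_support_subset hsupp).mono fun x hx => hx₀.subset hx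
    have hmul := hint h hh
    rw [integral_congr_ae (g := fun _ => (starRingEnd 𝕜) (f x₀) * h x₀)
      (hae.mono fun x hx => by simp only [hx])] at hmul
    have hfx₀ : ‖f x₀‖ = ‖f‖ := hx₀.superset rfl
    have hne : f x₀ ≠ 0 := by
      rw [← norm_pos_iff, hfx₀]
      exact Metric.infDist_nonneg.trans_lt hf
    simpa [hne] using hmul
  · have hfx₀ : ‖f x₀‖ = ‖f‖ := hx₀.superset rfl
    have := (f + h).norm_coe_le_norm x₀
    rwa [BoundedContinuousFunction.coe_add, Pi.add_apply, hB h hh, add_zero, hfx₀] at this
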